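/- Call a real sequence $(a_k)_{k\ge 0}$ totally positive if all minors (of all finite orders) of the infinite Toeplitz matrix $(a_{j-i})_{i,j\ge 0}$, where $a_k=0$ for $k<0$, are nonnegative, and let $\widetilde{\mathrm{TP}}_\infty$ be the set of generating series $\sum_{k\ge 0} a_kz^k$ of totally positive sequences. For real $a\neq 0$ let $g_a(z)=\sum_{k=0}^\infty z^k/a^{k(k-1)}$ be the partial theta function, and let $f*g$ denote the termwise product $\sum_k a_kb_kz^k$ of the series $f=\sum_k a_kz^k$ and $g=\sum_k b_kz^k$. Theorem. Let $q_2,q_3,\dots$ be nonzero real numbers such that $$f(z)=1+z+\sum_{k=2}^\infty \frac{z^k}{q_2^{k-1}q_3^{k-2}\cdots q_k}\in\widetilde{\mathrm{TP}}_\infty .$$ Then for every real $a$ with $a^2\ge 3.503$, $$(f*g_a)(z)=1+z+\sum_{k=2}^\infty \frac{z^k}{a^{k(k-1)}\,q_2^{k-1}q_3^{k-2}\cdots q_k}\in\widetilde{\mathrm{TP}}_\infty .$$ -/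

import Mathlib

/-- The infinite upper triangular Toeplitz matrix `(a_{j-i})_{i,j ≥ 0}` of a real sequence, with
the convention `a_k = 0` for `k < 0`. -/
def toeplitzMatrix (a : ℕ → ℝ) : Matrix ℕ ℕ ℝ :=
  Matrix.of fun i j => if i ≤ j then a (j - i) else 0

/-- A real sequence is totally positive if all minors of its infinite Toeplitz matrix (of every
finite order, with rows `r 0 < r 1 < ⋯` and columns `c 0 < c 1 < ⋯`) are nonnegative. -/
def IsTotallyPositive (a : ℕ → ℝ) : Prop :=
  ∀ (n : ℕ) (r c : Fin n → ℕ), StrictMono r → StrictMono c →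
    0 ≤ ((toeplitzMatrix a).submatrix r c).det

/-- The class of generating functions `∑ a_k z^k` of totally positive sequences. -/
def totallyPositiveSeries : Set (PowerSeries ℝ) :=
  {f | ∃ a : ℕ → ℝ, IsTotallyPositive a ∧ f = PowerSeries.mk a}

/-- The termwise (Hadamard) product `(f * g)(z) = ∑ a_k b_k z^k` of `f(z) = ∑ a_k z^k` and
`g(z) = ∑ b_k z^k`. -/
noncomputable def termwiseProduct (f g : PowerSeries ℝ) : PowerSeries ℝ :=
  PowerSeries.mk fun k => PowerSeries.coeff k f * PowerSeries.coeff k g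

/-- The partial theta function `g_a(z) = ∑ z^k / a^{k(k-1)}`. -/
noncomputable def partialTheta (a : ℝ) : PowerSeries ℝ :=
  PowerSeries.mk fun k => 1 / a ^ (k * (k - 1))

/-- The series `1 + z + ∑_{k ≥ 2} z^k / (q_2^{k-1} q_3^{k-2} ⋯ q_k)` with second quotients
`q_2, q_3, …`; for `k = 0` and `k = 1` the product is empty. The values `q 0`, `q 1` are not used. -/
noncomputable def seriesOfSecondQuotients (q : ℕ → ℝ) : PowerSeries ℝ :=
  PowerSeries.mk fun k => 1 / ∏ j ∈ Finset.Icc 2 k, q j ^ (k + 1 - j)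

/-!
Let `u k = a (k-1) * a (k+1) / a k ^ 2` be the inverse second quotients of a totally positive
sequence `a` of positive numbers, and `c ≥ 3.503` the square of the theta parameter. The product
with the partial theta function has the inverse second quotients `u k / c`. Total positivity of the
original sequence is used only through its minors of order two, which give `u k ≤ 1`, and of order
three, which give `u k ^ 2 * (1 - u (k-1)) * (1 - u (k+1)) ≤ (1 - u k) ^ 2`
(`IsTotallyPositive.inverseSecondQuotient_mul_le`).

A polynomial `∑ b j z ^ j` with positive coefficients has only real zeros if it takes alternating
signs at enough points of the negative axis. The natural point of index `k` is the one where the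
monomials of degree `k ± 1` both have `s` times the absolute value of the monomial of degree `k`;
here `s ^ 2 = b (k-1) * b (k+1) / b k ^ 2`. If `s < 1/2`, the monomial of degree `k` outweighs these
two, and the remaining ones form two alternating sums with decreasing terms. This is Hutchinson's
argument, which settles `c > 4`. If `s ≥ 1/2`, then `u k` is close to `1`, the inequality of order
three forces `u (k-1) + u (k+1)` to be at least about `1`, and the terms of degree `k ± 2` make up
for the deficit `2 s - 1` (`central_terms_pos`).

The latter case needs the term of degree `k + 2`, so a mere truncation of the series need not have
only real zeros. Therefore, the second quotients are first increased beyond an index `m` by factors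
growing slowly as powers of `1.07` (`dampedTheta`); two steps suffice to pass `4`, after which the
polynomial may be cut off. A real polynomial with nonpositive zeros has totally positive
coefficients, since multiplication by `X + ρ` with `ρ ≥ 0` preserves total positivity
(`IsTotallyPositive.mul_X_add_C`). Every single minor of the product series is a minor of such a
polynomial once `m` is large, so no limit is needed.
-/

open Finset

/-! ### Total positivity of polynomials with only nonpositive zeros -/

theorem IsTotallyPositive.const {l : ℝ} (hl : 0 ≤ l) :
    IsTotallyPositive fun k => (Polynomial.C l).coeff k := by
  intro n r c hr hc
  have key : ∀ i j, ((toeplitzMatrix fun k => (Polynomial.C l).coeff k).submatrix r c) i j =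
      if r i = c j then l else 0 := by
    intro i j
    simp only [Matrix.submatrix_apply, toeplitzMatrix, Matrix.of_apply, Polynomial.coeff_C]
    split_ifs <;> first | rfl | omega
  by_cases h : Set.range r = Set.range c
  · have hrc : r = c := (StrictMono.range_inj hr hc).1 h
    have : (toeplitzMatrix fun k => (Polynomial.C l).coeff k).submatrix r c =
        Matrix.diagonal fun _ => l := by
      ext i j
      rw [key, Matrix.diagonal_apply, hrc]
      simp [hc.injective.eq_iff]
    rw [this, Matrix.det_diagonal]
    exact Finset.prod_nonneg fun _ _ => hl
  · apply le_of_eq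
    symm
    by_cases h1 : ∃ i, r i ∉ Set.range c
    · obtain ⟨i, hi⟩ := h1
      refine Matrix.det_eq_zero_of_row_eq_zero i fun j => ?_
      rw [key, if_neg]
      exact fun e => hi ⟨j, e.symm⟩
    · have h2 : ∃ j, c j ∉ Set.range r := by
        by_contra h2
        push Not at h1 h2
        apply h
        ext x
        constructor
        · rintro ⟨i, rfl⟩; exact h1 i
        · rintro ⟨i, rfl⟩; exact h2 i
      obtain ⟨j, hj⟩ := h2
      refine Matrix.det_eq_zero_of_column_eq_zero j fun i => ?_
      rw [key, if_neg]
      exact fun e => hj ⟨i, e⟩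

/-- Each column of the Toeplitz matrix of `p * (X + ρ)` is `ρ` times the same column of that of
`p` plus the preceding column, so by multilinearity a minor of the former is a combination, with
powers of `ρ` as coefficients, of minors of the latter. -/
theorem IsTotallyPositive.mul_X_add_C {p : Polynomial ℝ} (hp : IsTotallyPositive p.coeff) {ρ : ℝ}
    (hρ : 0 ≤ ρ) : IsTotallyPositive (p * (Polynomial.X + Polynomial.C ρ)).coeff := by
  intro n r c hr hc
  set A := toeplitzMatrix p.coeff with hA
  let v : Fin n → Fin n → ℝ := fun l i => A (r i) (c l)
  let w : Fin n → Fin n → ℝ := fun l i => if c l = 0 then 0 else A (r i) (c l - 1)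
  have hM : ((toeplitzMatrix (p * (Polynomial.X + Polynomial.C ρ)).coeff).submatrix r c).transpose
      = (fun l => ρ • v l) + w := by
    ext l i
    simp only [Matrix.transpose_apply, Matrix.submatrix_apply, toeplitzMatrix, Matrix.of_apply,
      Pi.add_apply, Pi.smul_apply, smul_eq_mul, v, w, hA, mul_add, Polynomial.coeff_add,
      Polynomial.coeff_mul_C]
    rcases Nat.eq_zero_or_pos (c l) with h0 | h0
    · rw [h0]
      by_cases h : r i ≤ 0
      · simp [h, mul_comm]
      · simp [h]
    · by_cases h : r i ≤ c l - 1
      · have h1 : r i ≤ c l := by omega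
        have h2 : c l - r i = (c l - 1 - r i) + 1 := by omega
        rw [if_pos h1, if_pos h1, if_neg (by omega), if_pos h, h2, Polynomial.coeff_mul_X]
        ring
      · by_cases h1 : r i ≤ c l
        · have h2 : c l - r i = 0 := by omega
          rw [if_pos h1, if_pos h1, if_neg (by omega), if_neg h, h2]
          simp [mul_comm]
        · rw [if_neg h1, if_neg h1, if_neg (by omega), if_neg h]
          simp
  rw [← Matrix.det_transpose, hM]
  change 0 ≤ (Matrix.detRowAlternating : (Fin n → ℝ) [⋀^Fin n]→ₗ[ℝ] ℝ).toMultilinearMap _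
  rw [MultilinearMap.map_add_univ]
  refine Finset.sum_nonneg fun s _ => ?_
  have hs : s.piecewise (fun l => ρ • v l) w =
      s.piecewise (fun l => (fun _ => ρ : Fin n → ℝ) l • (s.piecewise v w) l) (s.piecewise v w) := by
    ext l i
    by_cases h : l ∈ s <;> simp [h]
  rw [hs, MultilinearMap.map_piecewise_smul, smul_eq_mul]
  refine mul_nonneg (Finset.prod_nonneg fun _ _ => hρ) ?_
  change 0 ≤ Matrix.det (Matrix.of (s.piecewise v w))
  by_cases hz : ∃ l, l ∉ s ∧ c l = 0
  · obtain ⟨l, hl, h0⟩ := hz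
    refine le_of_eq (Matrix.det_eq_zero_of_row_eq_zero l fun i => ?_).symm
    simp [hl, w, h0]
  push Not at hz
  let e : Fin n → ℕ := fun l => if l ∈ s then c l else c l - 1
  have he : Matrix.of (s.piecewise v w) = (A.submatrix r e).transpose := by
    ext l i
    by_cases h : l ∈ s
    · simp [h, v, e]
    · simp [h, w, e, hz l h]
  rw [he, Matrix.det_transpose]
  have hmono : Monotone e := by
    intro l l' hll
    rcases hll.eq_or_lt with rfl | h
    · exact le_rfl
    · have := hc h
      simp only [e]
      split_ifs <;> omega
  by_cases hinj : Function.Injective e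
  · exact hp n r e hr (hmono.strictMono_of_injective hinj)
  · simp only [Function.Injective] at hinj
    push Not at hinj
    obtain ⟨l, l', hll, hne⟩ := hinj
    refine le_of_eq (Matrix.det_zero_of_column_eq hne fun i => ?_).symm
    simp [hll]

/-- The elementary half of the Aissen–Schoenberg–Whitney theorem, for polynomials. -/
theorem Polynomial.isTotallyPositive_coeff_of_roots {p : Polynomial ℝ}
    (hcard : p.roots.card = p.natDegree) (hlead : 0 ≤ p.leadingCoeff)
    (hroots : ∀ x ∈ p.roots, x ≤ 0) : IsTotallyPositive p.coeff := by
  have key : ∀ s : Multiset ℝ, (∀ x ∈ s, x ≤ 0) → IsTotallyPositive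
      (Polynomial.C p.leadingCoeff * (s.map fun x => Polynomial.X - Polynomial.C x).prod).coeff := by
    intro s
    induction s using Multiset.induction_on with
    | empty => intro _; simpa using IsTotallyPositive.const hlead
    | cons x s ih =>
      intro h
      have h1 := (ih fun y hy => h y (Multiset.mem_cons_of_mem hy)).mul_X_add_C
        (neg_nonneg.2 (h x (Multiset.mem_cons_self x s)))
      rw [Polynomial.C_neg, ← sub_eq_add_neg] at h1
      rw [Multiset.map_cons, Multiset.prod_cons, mul_comm (Polynomial.X - _), ← mul_assoc]
      exact h1
  have := key p.roots hroots
  rwa [Polynomial.C_leadingCoeff_mul_prod_multiset_X_sub_C hcard] at this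

/-! ### Counting zeros by sign changes -/

theorem Polynomial.le_card_roots_of_alternating {p : Polynomial ℝ} {n : ℕ} {x : ℕ → ℝ}
    (hx : StrictMono x) (hsign : ∀ k ≤ n, 0 < (-1) ^ k * p.eval (-x k)) :
    n ≤ p.roots.card := by
  have hp : p ≠ 0 := by
    rintro rfl
    simpa using hsign 0 (Nat.zero_le n)
  have hex : ∀ k : Fin n, ∃ y ∈ Set.Ioo (x k) (x (k + 1)), p.eval (-y) = 0 := by
    intro k
    have hcont : ContinuousOn (fun y => (-1 : ℝ) ^ (k : ℕ) * p.eval (-y))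
        (Set.Icc (x k) (x (k + 1))) := by fun_prop
    have h0 := hsign k k.2.le
    have h1 := hsign (k + 1) k.2
    rw [pow_succ] at h1
    obtain ⟨y, hy, hy0⟩ := intermediate_value_Ioo' (hx (Nat.lt_add_one k)).le hcont
      (show (0 : ℝ) ∈ _ from ⟨by linarith, h0⟩)
    refine ⟨y, hy, ?_⟩
    simpa using hy0
  choose y hy hy0 using hex
  have hinj : Function.Injective fun k => -y k := by
    have : StrictMono y := fun k l hkl =>
      (hy k).2.trans_le ((hx.monotone (Nat.succ_le_of_lt hkl)).trans (hy l).1.le)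
    exact neg_injective.comp this.injective
  calc n = (univ.image fun k => -y k).card := by
        rw [card_image_of_injective _ hinj, card_univ, Fintype.card_fin]
    _ ≤ p.roots.toFinset.card := by
        refine card_le_card fun z hz => ?_
        obtain ⟨k, -, rfl⟩ := mem_image.1 hz
        simpa [hp] using hy0 k
    _ ≤ p.roots.card := Multiset.toFinset_card_le _

/-! ### Alternating sums of rapidly decreasing terms -/

theorem alternating_sum_mem_Icc (M : ℕ) (t : ℕ → ℝ) (h0 : ∀ i ≤ M, 0 ≤ t i)
    (h : ∀ i < M, t (i + 1) ≤ 1 / 20 * t i) :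
    ∑ i ∈ range (M + 1), (-1) ^ i * t i ∈ Set.Icc (19 / 20 * t 0) (t 0) := by
  induction M generalizing t with
  | zero =>
    have := h0 0 le_rfl
    simp only [zero_add, sum_range_one, pow_zero, one_mul, Set.mem_Icc, le_refl, and_true]
    linarith
  | succ M ih =>
    have h1 := ih (fun i => t (i + 1)) (fun i hi => h0 _ (by omega)) fun i hi => h _ (by omega)
    have h2 := h 0 (by omega)
    have h3 := h0 1 (by omega)
    rw [sum_range_succ']
    have h4 : ∑ i ∈ range (M + 1), (-1 : ℝ) ^ (i + 1) * t (i + 1) =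
        -∑ i ∈ range (M + 1), (-1 : ℝ) ^ i * t (i + 1) := by
      rw [← sum_neg_distrib]
      exact sum_congr rfl fun i _ => by ring
    rw [h4]
    simp only [zero_add, Set.mem_Icc, pow_zero, one_mul] at h1 h2 ⊢
    constructor <;> linarith

/-- Strong log-concavity together with `t 1 ≤ 3/5 t 0` makes the terms decrease by the factor
`3/5 * (2/7)^2 < 1/20` from the third term on. The number `T` stands for `t 2` when that term is
present in the sum. -/
theorem le_alternating_sum {N : ℕ} {t : ℕ → ℝ} {T : ℝ} (hN : 1 ≤ N) (hpos : ∀ i ≤ N, 0 < t i)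
    (hlc : ∀ i, i + 2 ≤ N → t i * t (i + 2) ≤ 2 / 7 * t (i + 1) ^ 2) (h1 : t 1 ≤ 3 / 5 * t 0)
    (hT : 2 ≤ N → T ≤ t 2) (hT' : N < 2 → T ≤ 0) :
    t 0 - t 1 + 19 / 20 * T ≤ ∑ i ∈ range (N + 1), (-1) ^ i * t i := by
  have ratio : ∀ i, i + 1 ≤ N → t (i + 1) ≤ 3 / 5 * (2 / 7) ^ i * t i := by
    intro i
    induction i with
    | zero => intro _; simpa using h1
    | succ i ih =>
      intro hi
      have a0 := hpos i (by omega)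
      have a1 := hpos (i + 1) (by omega)
      have := hlc i (by omega)
      have ih := ih (by omega)
      have e : t i * t (i + 1 + 1) ≤ t i * (3 / 5 * (2 / 7) ^ (i + 1) * t (i + 1)) :=
        calc t i * t (i + 1 + 1) ≤ 2 / 7 * t (i + 1) * t (i + 1) := by
              rw [mul_assoc, ← pow_two]; exact this
          _ ≤ 2 / 7 * t (i + 1) * (3 / 5 * (2 / 7) ^ i * t i) := by gcongr
          _ = _ := by ring
      exact le_of_mul_le_mul_left e a0
  obtain ⟨N, rfl⟩ : ∃ K, N = K + 1 := ⟨N - 1, by omega⟩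
  rw [sum_range_succ', sum_range_succ']
  rcases Nat.eq_zero_or_pos N with rfl | hN'
  · have := hT' (by omega)
    simp
    linarith
  · obtain ⟨M, rfl⟩ : ∃ K, N = K + 1 := ⟨N - 1, by omega⟩
    have hs := (alternating_sum_mem_Icc M (fun i => t (i + 2)) (fun i hi => (hpos _ (by omega)).le)
      (fun i hi => by
        refine (ratio (i + 2) (by omega)).trans ?_
        have := hpos (i + 2) (by omega)
        have h3 : (2 / 7 : ℝ) ^ i ≤ 1 := pow_le_one₀ (by norm_num) (by norm_num)
        have : 3 / 5 * (2 / 7 : ℝ) ^ (i + 2) ≤ 1 / 20 := by rw [pow_add]; linarith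
        gcongr)).1
    have h5 : ∑ i ∈ range (M + 1), (-1 : ℝ) ^ (i + 1 + 1) * t (i + 1 + 1) =
        ∑ i ∈ range (M + 1), (-1 : ℝ) ^ i * t (i + 2) :=
      sum_congr rfl fun i _ => by ring
    have := hT (by omega)
    rw [h5]
    simp only [zero_add, pow_zero, pow_one, one_mul] at hs ⊢
    linarith

theorem sum_range_split_at {f : ℕ → ℝ} {k n : ℕ} (hk : k ≤ n) :
    ∑ j ∈ range (n + 1), f j =
      ∑ i ∈ range (k + 1), f (k - i) + ∑ i ∈ range (n - k + 1), f (k + i) - f k := by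
  have h1 : ∑ i ∈ range (k + 1), f (k - i) = ∑ j ∈ range (k + 1), f j := by
    simpa using sum_range_reflect f (k + 1)
  have h2 : n + 1 = k + (n - k + 1) := by omega
  rw [h1, h2, sum_range_add, sum_range_succ f k]
  ring

/-! ### Inverse second quotients -/

/-- The inverse second quotients `a_{k-1} a_{k+1} / a_k ^ 2` of a sequence, where `a_{-1} = 0`, so
that the value at `k = 0` is `0`. -/
noncomputable def inverseSecondQuotient (a : ℕ → ℝ) : ℕ → ℝ
  | 0 => 0
  | k + 1 => a k * a (k + 2) / a (k + 1) ^ 2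

theorem inverseSecondQuotient_nonneg {a : ℕ → ℝ} (ha : ∀ k, 0 < a k) (k : ℕ) :
    0 ≤ inverseSecondQuotient a k := by
  cases k with
  | zero => exact le_rfl
  | succ k =>
    have := ha k
    have := ha (k + 1)
    have := ha (k + 2)
    simp only [inverseSecondQuotient]
    positivity

theorem IsTotallyPositive.nonneg {a : ℕ → ℝ} (h : IsTotallyPositive a) (k : ℕ) : 0 ≤ a k := by
  have := h 1 ![0] ![k] (Subsingleton.strictMono _) (Subsingleton.strictMono _)
  rw [Matrix.det_fin_one] at this
  simpa [toeplitzMatrix] using this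

theorem IsTotallyPositive.inverseSecondQuotient_le_one {a : ℕ → ℝ} (h : IsTotallyPositive a)
    (ha : ∀ k, 0 < a k) (k : ℕ) : inverseSecondQuotient a k ≤ 1 := by
  cases k with
  | zero => exact zero_le_one
  | succ k =>
    have := h 2 ![0, 1] ![k + 1, k + 2] (by intro i j; fin_cases i <;> fin_cases j <;> simp)
      (by intro i j; fin_cases i <;> fin_cases j <;> simp)
    simp only [toeplitzMatrix, Matrix.det_fin_two, Matrix.submatrix_apply, Matrix.of_apply] at this
    simp at this
    have := ha (k + 1)
    simp only [inverseSecondQuotient]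
    rw [div_le_one (by positivity)]
    nlinarith

/-- If a second quotient is close to `1`, then at least one of its two neighbours is. This is the
nonnegativity of the `3 × 3` minor with rows `0, 1, 2` and columns `k + 1, k + 2, k + 3`. -/
theorem IsTotallyPositive.inverseSecondQuotient_mul_le {a : ℕ → ℝ} (h : IsTotallyPositive a)
    (ha : ∀ k, 0 < a k) (k : ℕ) :
    inverseSecondQuotient a (k + 1) ^ 2 *
      ((1 - inverseSecondQuotient a k) * (1 - inverseSecondQuotient a (k + 2))) ≤
      (1 - inverseSecondQuotient a (k + 1)) ^ 2 := by
  have hm := h 3 ![0, 1, 2] ![k + 1, k + 2, k + 3]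
    (by intro i j; fin_cases i <;> fin_cases j <;> simp)
    (by intro i j; fin_cases i <;> fin_cases j <;> simp)
  simp only [toeplitzMatrix, Matrix.det_fin_three, Matrix.submatrix_apply, Matrix.of_apply] at hm
  rw [← sub_nonneg]
  cases k with
  | zero =>
    simp at hm
    have h0 := ha 0
    have h1 := ha 1
    have h2 := ha 2
    have h3 := ha 3
    simp only [inverseSecondQuotient, zero_add]
    refine (div_nonneg hm (pow_pos h1 3).le).trans_eq ?_
    field_simp
    ring
  | succ k =>
    simp at hm
    have h0 := ha k
    have h1 := ha (k + 1)
    have h2 := ha (k + 2)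
    have h3 := ha (k + 3)
    have h4 := ha (k + 4)
    simp only [inverseSecondQuotient, add_assoc, Nat.reduceAdd] at hm ⊢
    refine (div_nonneg (sub_nonneg.2 hm) (pow_pos h2 3).le).trans_eq ?_
    field_simp
    ring

/-! ### Sign alternation -/

/-- The monomial `b_{k+1} x ^ (k+1)` dominates when `x` is chosen so that its two neighbours both
equal `s` times it. The numbers `L` and `R` bound the terms of index `k - 1` and `k + 3`, as far as
these occur in the sum. -/
theorem alternating_sign {b : ℕ → ℝ} (hb : ∀ k, 0 < b k)
    (hlc : ∀ k, b k * b (k + 2) ≤ 2 / 7 * b (k + 1) ^ 2) {n k : ℕ} (hk : k + 1 ≤ n)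
    {x s L R : ℝ} (hx : 0 < x) (hs : s ≤ 3 / 5) (e1 : b k = s * x * b (k + 1))
    (e2 : b (k + 2) * x = s * b (k + 1))
    (hL : 1 ≤ k → L ≤ b (k - 1) * x ^ (k - 1)) (hL' : k < 1 → L ≤ 0)
    (hR : k + 3 ≤ n → R ≤ b (k + 3) * x ^ (k + 3)) (hR' : n < k + 3 → R ≤ 0)
    (hpos : 0 < b (k + 1) * x ^ (k + 1) * (1 - 2 * s) + 19 / 20 * (L + R)) :
    0 < (-1) ^ (k + 1) * ∑ j ∈ range (n + 1), b j * (-x) ^ j := by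
  have hpow : ∀ i j : ℕ, (-1 : ℝ) ^ i * (b j * (-x) ^ j) = (-1) ^ (i + j) * (b j * x ^ j) := by
    intro i j
    rw [neg_pow, pow_add]; ring
  have hlcx : ∀ i, b i * x ^ i * (b (i + 2) * x ^ (i + 2)) ≤ 2 / 7 * (b (i + 1) * x ^ (i + 1)) ^ 2 := by
    intro i
    calc b i * x ^ i * (b (i + 2) * x ^ (i + 2)) = b i * b (i + 2) * (x ^ (i + 1)) ^ 2 := by ring
      _ ≤ 2 / 7 * b (i + 1) ^ 2 * (x ^ (i + 1)) ^ 2 := 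
          mul_le_mul_of_nonneg_right (hlc i) (sq_nonneg _)
      _ = _ := by ring
  have ht0 : 0 < b (k + 1) * x ^ (k + 1) := mul_pos (hb _) (pow_pos hx _)
  have hs0 : 0 < s := by
    have h1 := hb (k + 1)
    have h2 := mul_pos (hb (k + 2)) hx
    rw [e2] at h2
    exact pos_of_mul_pos_left h2 h1.le
  have el : b k * x ^ k = s * (b (k + 1) * x ^ (k + 1)) := by rw [e1]; ring
  have er : b (k + 2) * x ^ (k + 2) = s * (b (k + 1) * x ^ (k + 1)) := by
    rw [pow_succ', ← mul_assoc, e2]; ring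
  have hst : s * (b (k + 1) * x ^ (k + 1)) ≤ 3 / 5 * (b (k + 1) * x ^ (k + 1)) := by gcongr
  have hleft := le_alternating_sum (N := k + 1) (t := fun i => b (k + 1 - i) * x ^ (k + 1 - i))
    (T := L) (by omega) (fun i _ => mul_pos (hb _) (pow_pos hx _))
    (fun i hi => by
      have := hlcx (k + 1 - (i + 2))
      rw [show k + 1 - (i + 2) + 2 = k + 1 - i by omega,
        show k + 1 - (i + 2) + 1 = k + 1 - (i + 1) by omega] at this
      rw [mul_comm]; exact this)
    (by simpa [el] using hst) (fun h => hL (by omega)) (fun h => hL' (by omega))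
  have hsplit := sum_range_split_at (f := fun j => (-1 : ℝ) ^ (k + 1) * (b j * (-x) ^ j)) hk
  rw [mul_sum, hsplit]
  have c1 : ∀ i ∈ range (k + 1 + 1), (-1 : ℝ) ^ (k + 1) * (b (k + 1 - i) * (-x) ^ (k + 1 - i)) =
      (-1) ^ i * (b (k + 1 - i) * x ^ (k + 1 - i)) := by
    intro i hi
    have := mem_range.1 hi
    rw [hpow, show k + 1 + (k + 1 - i) = 2 * (k + 1 - i) + i by omega, pow_add, pow_mul]
    norm_num
  have c2 : ∀ i, (-1 : ℝ) ^ (k + 1) * (b (k + 1 + i) * (-x) ^ (k + 1 + i)) =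
      (-1) ^ i * (b (k + 1 + i) * x ^ (k + 1 + i)) := by
    intro i
    rw [hpow, show k + 1 + (k + 1 + i) = 2 * (k + 1) + i by omega, pow_add, pow_mul]
    norm_num
  have c3 := c2 0
  simp only [add_zero, pow_zero, one_mul] at c3
  simp only [c3]
  rw [sum_congr rfl c1, sum_congr rfl fun i _ => c2 i]
  simp only [Nat.sub_zero, Nat.add_sub_cancel, el] at hleft
  rcases hk.eq_or_lt with h | h
  · subst h
    have := hR' (by omega)
    have := mul_pos hs0 ht0
    rw [Nat.sub_self, zero_add, sum_range_one]
    simp only [pow_zero, add_zero, one_mul]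
    linarith
  · have hright := le_alternating_sum (N := n - (k + 1))
      (t := fun i => b (k + 1 + i) * x ^ (k + 1 + i))
      (T := R) (by omega) (fun i _ => mul_pos (hb _) (pow_pos hx _))
      (fun i _ => hlcx (k + 1 + i))
      (by
        change b (k + 2) * x ^ (k + 2) ≤ _
        simpa [er] using hst) (fun h => hR (by omega)) (fun h => hR' (by omega))
    change b (k + 1) * x ^ (k + 1) - b (k + 2) * x ^ (k + 2) + _ ≤ _ at hright
    rw [er] at hright
    linarith

/-- A criterion in terms of the inverse second quotients for a polynomial to have only real zeros,
hence totally positive coefficients. -/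
theorem isTotallyPositive_truncation {b : ℕ → ℝ} (hb : ∀ k, 0 < b k) {n : ℕ}
    (hU : ∀ k, inverseSecondQuotient b k ≤ 2 / 7)
    (hcond : ∀ k, k + 1 ≤ n → ∀ s, 0 < s → s ^ 2 = inverseSecondQuotient b (k + 1) →
      0 < 1 - 2 * s + 19 / 20 * (s ^ 2 * (inverseSecondQuotient b k +
        if k + 3 ≤ n then inverseSecondQuotient b (k + 2) else 0))) :
    IsTotallyPositive fun k => if k ≤ n then b k else 0 := by
  have hUe : ∀ k, inverseSecondQuotient b (k + 1) * b (k + 1) ^ 2 = b k * b (k + 2) := by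
    intro k
    have := hb (k + 1)
    simp only [inverseSecondQuotient]
    field_simp
  have hlc : ∀ k, b k * b (k + 2) ≤ 2 / 7 * b (k + 1) ^ 2 := by
    intro k
    rw [← hUe]
    have := hU (k + 1)
    gcongr
  -- At `-x k` the monomials of degree `k - 1` and `k + 1` have the same absolute value.
  let x : ℕ → ℝ := fun k => if k = 0 then 0 else √(b (k - 1) / b (k + 1))
  have hx0 : x 0 = 0 := by simp [x]
  have hx1 : ∀ k, x (k + 1) = √(b k / b (k + 2)) := fun k => by simp [x]
  have hx : StrictMono x := by
    refine strictMono_nat_of_lt_succ fun k => ?_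
    cases k with
    | zero =>
      rw [hx0, hx1]
      exact Real.sqrt_pos.2 (div_pos (hb _) (hb _))
    | succ k =>
      rw [hx1, hx1]
      have h0 := hb k
      have h1 := hb (k + 1)
      have h2 := hb (k + 2)
      have h3 := hb (k + 3)
      refine Real.sqrt_lt_sqrt (div_pos h0 h2).le ?_
      rw [div_lt_div_iff₀ h2 h3]
      have a1 := hlc k
      have a2 := hlc (k + 1)
      simp only [add_assoc, Nat.reduceAdd] at a2 ⊢
      have a3 : b k * b (k + 2) * (b (k + 1) * b (k + 3)) ≤
          2 / 7 * b (k + 1) ^ 2 * (2 / 7 * b (k + 2) ^ 2) := by gcongr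
      have a4 : 0 < b (k + 1) * b (k + 2) := mul_pos h1 h2
      refine lt_of_mul_lt_mul_left ?_ a4.le
      nlinarith [mul_pos a4 a4]
  let p : Polynomial ℝ := ∑ j ∈ range (n + 1), Polynomial.monomial j (b j)
  have hcoeff : p.coeff = fun k => if k ≤ n then b k else 0 := by
    ext k
    simp [p, Polynomial.coeff_monomial]
  have hdeg : p.natDegree = n := by
    refine Polynomial.natDegree_eq_of_le_of_coeff_ne_zero ?_ ?_
    · exact Polynomial.natDegree_le_iff_coeff_eq_zero.2 fun k hk => by
        rw [hcoeff]; exact if_neg (by omega)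
    · rw [hcoeff]; simpa using (hb n).ne'
  have heval : ∀ y, p.eval y = ∑ j ∈ range (n + 1), b j * y ^ j := by
    intro y
    simp [p, Polynomial.eval_finsetSum]
  have hsign : ∀ k ≤ n, 0 < (-1) ^ k * p.eval (-x k) := by
    intro k hk
    rw [heval]
    cases k with
    | zero =>
      rw [hx0, sum_range_succ']
      simpa using hb 0
    | succ k =>
      have h0 := hb k
      have h1 := hb (k + 1)
      have h2 := hb (k + 2)
      have hUk : 0 < inverseSecondQuotient b (k + 1) := by
        simp only [inverseSecondQuotient]; positivity
      have hxpos : 0 < x (k + 1) := hx0 ▸ hx (Nat.succ_pos k)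
      have hxsq : x (k + 1) ^ 2 = b k / b (k + 2) := by
        rw [hx1, Real.sq_sqrt (div_pos h0 h2).le]
      obtain ⟨s, hs0, hssq⟩ : ∃ s, 0 < s ∧ s ^ 2 = inverseSecondQuotient b (k + 1) :=
        ⟨_, Real.sqrt_pos.2 hUk, Real.sq_sqrt hUk.le⟩
      have hs : s ≤ 3 / 5 := by
        have := hU (k + 1)
        nlinarith
      set y := x (k + 1)
      have e1 : b k = s * y * b (k + 1) := by
        refine (pow_left_inj₀ h0.le (by positivity) two_ne_zero).1 ?_
        rw [mul_pow, mul_pow, hssq, hxsq]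
        simp only [inverseSecondQuotient]
        field_simp
      have e2 : b (k + 2) * y = s * b (k + 1) := by
        refine (pow_left_inj₀ (by positivity) (by positivity) two_ne_zero).1 ?_
        rw [mul_pow, mul_pow, hssq, hxsq]
        simp only [inverseSecondQuotient]
        field_simp
      have ht := mul_pos h1 (pow_pos hxpos (k + 1))
      refine alternating_sign hb hlc hk hxpos hs e1 e2
        (L := b (k + 1) * y ^ (k + 1) * (s ^ 2 * inverseSecondQuotient b k))
        (R := b (k + 1) * y ^ (k + 1) *
          (s ^ 2 * if k + 3 ≤ n then inverseSecondQuotient b (k + 2) else 0))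
        ?_ ?_ ?_ ?_ ?_
      · intro hk1
        obtain ⟨k, rfl⟩ : ∃ i, k = i + 1 := ⟨k - 1, by omega⟩
        apply le_of_eq
        simp only [inverseSecondQuotient, add_assoc, Nat.reduceAdd, Nat.add_sub_cancel] at e1 ⊢
        rw [e1]
        field_simp
        ring
      · intro hk1
        obtain rfl : k = 0 := by omega
        simp [inverseSecondQuotient]
      · intro hk3
        rw [if_pos hk3]
        apply le_of_eq
        have e3 : s * b (k + 1) / y = b (k + 2) := by rw [← e2]; field_simp
        simp only [inverseSecondQuotient, add_assoc, Nat.reduceAdd]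
        rw [← e3]
        field_simp
        ring
      · intro hk3
        rw [if_neg (by omega)]
        simp
      · have := mul_pos ht (hcond k hk s hs0 hssq)
        linarith
  have hcard : p.roots.card = p.natDegree :=
    le_antisymm (Polynomial.card_roots' p)
      (hdeg.symm ▸ Polynomial.le_card_roots_of_alternating hx hsign)
  rw [← hcoeff]
  refine Polynomial.isTotallyPositive_coeff_of_roots hcard ?_ ?_
  · rw [Polynomial.leadingCoeff, hdeg, hcoeff]
    simpa using (hb n).le
  · intro y hy
    by_contra! h
    have h0 : p.eval y = 0 := (Polynomial.mem_roots'.1 hy).2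
    rw [heval] at h0
    have : 0 < ∑ j ∈ range (n + 1), b j * y ^ j :=
      sum_pos (fun j _ => mul_pos (hb j) (pow_pos h j)) ⟨0, by simp⟩
    linarith

/-! ### Total positivity of the product with the partial theta function -/

/-- The numerical heart of the argument. The relation between `u`, `v` and `w` gives
`(v + w) / u ≥ 1`, so the expression is at least `1 - 2s + 0.95 / 1.07 s ^ 4`, which is positive
for `s ^ 2 ≤ 1 / 3.503`. -/
theorem central_terms_pos {u v w d d₁ d₂ s : ℝ} (hu1 : u ≤ 1) (hv : 0 ≤ v) (hw : 0 ≤ w)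
    (h : u ^ 2 * ((1 - v) * (1 - w)) ≤ (1 - u) ^ 2) (hd : 3.503 ≤ d)
    (hd1 : 0 < d₁) (hd1' : d₁ ≤ d) (hd2 : 0 < d₂) (hd2' : d₂ ≤ 1.07 * d) (hs : 1 / 2 ≤ s)
    (hsu : s ^ 2 = u / d) :
    0 < 1 - 2 * s + 19 / 20 * (s ^ 2 * (v / d₁ + w / d₂)) := by
  have hd0 : 0 < d := by linarith
  have hu : u = s ^ 2 * d := by rw [hsu]; field_simp
  have hu0 : 0.87 ≤ u := by rw [hu]; nlinarith
  have hs' : s ≤ 0.5344 := by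
    have : s ^ 2 * 3.503 ≤ 1 := by nlinarith [sq_nonneg s]
    nlinarith
  have hvw : u ≤ v + w := by
    have h1 : u ^ 2 * u ≤ u ^ 2 * (v + w) := by
      have : u ^ 3 ≤ 2 * u - 1 := by nlinarith [mul_nonneg (sub_nonneg.2 hu1) (sub_nonneg.2 hu0)]
      nlinarith [mul_nonneg (sq_nonneg u) (mul_nonneg hv hw)]
    exact le_of_mul_le_mul_left h1 (by positivity)
  have h1 : v / (1.07 * d) ≤ v / d₁ := by gcongr; linarith
  have h2 : w / (1.07 * d) ≤ w / d₂ := by gcongr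
  have h3 : s ^ 2 / 1.07 ≤ v / d₁ + w / d₂ :=
    calc s ^ 2 / 1.07 = u / (1.07 * d) := by rw [hsu]; field_simp
      _ ≤ (v + w) / (1.07 * d) := by gcongr
      _ ≤ _ := by rw [add_div]; linarith
  have h4 : s ^ 2 * (s ^ 2 / 1.07) ≤ s ^ 2 * (v / d₁ + w / d₂) := by gcongr
  have h5 : 0 < 1 - 2 * s + 19 / 20 * (s ^ 2 * (s ^ 2 / 1.07)) := by
    -- The convex quartic lies above its tangent line at `0.5344`.
    have : s ^ 4 ≥ 0.5344 ^ 4 + 4 * 0.5344 ^ 3 * (s - 0.5344) := by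
      nlinarith [mul_nonneg (sq_nonneg (s - 0.5344))
        (by positivity : (0 : ℝ) ≤ s ^ 2 + 2 * 0.5344 * s + 3 * 0.5344 ^ 2)]
    norm_num at this ⊢
    nlinarith
  linarith

theorem choose_two_second_difference (j : ℕ) :
    j.choose 2 + (j + 2).choose 2 = 2 * (j + 1).choose 2 + 1 := by
  simp only [Nat.choose_succ_succ' _ 1, Nat.choose_one_right, Nat.reduceAdd]
  omega

theorem choose_three_second_difference (i : ℕ) :
    i.choose 3 + (i + 2).choose 3 = 2 * (i + 1).choose 3 + i := by
  simp only [Nat.choose_succ_succ' _ 2, Nat.choose_succ_succ' _ 1, Nat.choose_one_right, Nat.reduceAdd]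
  omega

/-- The coefficients of the partial theta function with parameter `√c`, modified beyond the index
`m` so that their second quotients are `c` up to that index and then `c * 1.07`, `c * 1.07 ^ 2`,
and so on. The exponent `(j + 1 - m).choose 3`, with truncated subtraction, has the second
difference `j - m`. -/
noncomputable def dampedTheta (c : ℝ) (m j : ℕ) : ℝ :=
  (c ^ j.choose 2)⁻¹ * (1.07 ^ (j + 1 - m).choose 3)⁻¹

theorem dampedTheta_pos {c : ℝ} (hc : 0 < c) (m j : ℕ) : 0 < dampedTheta c m j := by
  unfold dampedTheta
  positivity

theorem dampedTheta_second_quotient {c : ℝ} (hc : 0 < c) (m j : ℕ) :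
    dampedTheta c m j * dampedTheta c m (j + 2) =
      dampedTheta c m (j + 1) ^ 2 / (c * 1.07 ^ (j + 1 - m)) := by
  have h2 := choose_two_second_difference j
  have h3 : (j + 1 - m).choose 3 + (j + 2 + 1 - m).choose 3 =
      2 * (j + 1 + 1 - m).choose 3 + (j + 1 - m) := by
    rcases le_or_gt m (j + 1) with h | h
    · have := choose_three_second_difference (j + 1 - m)
      rwa [show j + 1 - m + 2 = j + 2 + 1 - m by omega,
        show j + 1 - m + 1 = j + 1 + 1 - m by omega] at this
    · rw [Nat.choose_eq_zero_of_lt (show j + 1 - m < 3 by omega),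
        Nat.choose_eq_zero_of_lt (show j + 2 + 1 - m < 3 by omega),
        Nat.choose_eq_zero_of_lt (show j + 1 + 1 - m < 3 by omega)]
      omega
  have hc2 : (c ^ j.choose 2)⁻¹ * (c ^ (j + 2).choose 2)⁻¹ = ((c ^ (j + 1).choose 2) ^ 2 * c)⁻¹ := by
    rw [← mul_inv, ← pow_add, h2, pow_succ, pow_mul']
  have hc3 : ((1.07 : ℝ) ^ (j + 1 - m).choose 3)⁻¹ * (1.07 ^ (j + 2 + 1 - m).choose 3)⁻¹ =
      ((1.07 ^ (j + 1 + 1 - m).choose 3) ^ 2 * 1.07 ^ (j + 1 - m))⁻¹ := by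
    rw [← mul_inv, ← pow_add, h3, pow_add, pow_mul']
  unfold dampedTheta
  rw [mul_mul_mul_comm, hc2, hc3]
  field_simp

theorem IsTotallyPositive.mul_partialTheta {a : ℕ → ℝ} (h : IsTotallyPositive a)
    (ha : ∀ k, 0 < a k) {c : ℝ} (hc : 3.503 ≤ c) :
    IsTotallyPositive fun k => a k * (c ^ k.choose 2)⁻¹ := by
  have hc0 : 0 < c := by linarith
  intro N r col hr hcol
  -- All entries of the minor have index at most `m`.
  let m := ∑ l, col l
  let b : ℕ → ℝ := fun j => a j * dampedTheta c m j
  let d : ℕ → ℝ := fun j => c * 1.07 ^ (j - m)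
  have hb : ∀ k, 0 < b k := fun k => mul_pos (ha k) (dampedTheta_pos hc0 m k)
  have hd : ∀ k, 3.503 ≤ d k := fun k => by
    have : (1 : ℝ) ≤ 1.07 ^ (k - m) := one_le_pow₀ (by norm_num)
    simp only [d]
    nlinarith
  have hdpos : ∀ k, 0 < d k := fun k => by linarith [hd k]
  have hU : ∀ k, inverseSecondQuotient b k = inverseSecondQuotient a k / d k := by
    intro k
    cases k with
    | zero => simp [inverseSecondQuotient]
    | succ k =>
      have h1 := ha (k + 1)
      have h2 := dampedTheta_pos hc0 m (k + 1)
      have h3 := hdpos (k + 1)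
      simp only [inverseSecondQuotient, b]
      rw [mul_mul_mul_comm, dampedTheta_second_quotient hc0]
      simp only [d] at h3 ⊢
      field_simp
  have hu0 := inverseSecondQuotient_nonneg ha
  have hu1 := h.inverseSecondQuotient_le_one ha
  have key : IsTotallyPositive fun k => if k ≤ m + 3 then b k else 0 := by
    refine isTotallyPositive_truncation hb (fun k => ?_) fun k hk s hs hsq => ?_
    · rw [hU, div_le_iff₀ (hdpos k)]
      linarith [hd k, hu1 k]
    · rw [hU] at hsq
      rcases lt_or_ge s (1 / 2) with hs2 | hs2
      · have h1 : 0 ≤ inverseSecondQuotient b k := inverseSecondQuotient_nonneg hb k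
        have h2 : 0 ≤ if k + 3 ≤ m + 3 then inverseSecondQuotient b (k + 2) else 0 := by
          split_ifs
          · exact inverseSecondQuotient_nonneg hb _
          · exact le_rfl
        have : 0 ≤ s ^ 2 * (inverseSecondQuotient b k +
            if k + 3 ≤ m + 3 then inverseSecondQuotient b (k + 2) else 0) := by positivity
        linarith
      · have hkm : k + 3 ≤ m + 3 := by
          -- Otherwise `d (k + 1) ≥ 3.503 * 1.07 ^ 2 > 4`, so that `s < 1 / 2`.
          by_contra hkm
          have h1 : (1.07 : ℝ) ^ 2 ≤ 1.07 ^ (k + 1 - m) :=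
            pow_le_pow_right₀ (by norm_num) (by omega)
          have h2 : 4 < d (k + 1) := by simp only [d]; nlinarith
          have h3 := hu1 (k + 1)
          rw [eq_div_iff (hdpos _).ne'] at hsq
          have h4 : 1 / 4 * d (k + 1) ≤ s ^ 2 * d (k + 1) :=
            mul_le_mul_of_nonneg_right (by nlinarith) (hdpos _).le
          linarith
        rw [if_pos hkm, hU, hU]
        refine central_terms_pos (hu1 (k + 1)) (hu0 k) (hu0 (k + 2))
          (h.inverseSecondQuotient_mul_le ha k) (hd (k + 1)) (hdpos k) ?_ (hdpos (k + 2)) ?_ hs2 hsq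
        · simp only [d]
          gcongr
          · norm_num
          · omega
        · have : (1.07 : ℝ) ^ (k + 2 - m) ≤ 1.07 ^ (k + 1 - m + 1) :=
            pow_le_pow_right₀ (by norm_num) (by omega)
          simp only [d]
          rw [pow_succ] at this
          nlinarith
  convert key N r col hr hcol using 2
  ext i j
  simp only [toeplitzMatrix, Matrix.submatrix_apply, Matrix.of_apply]
  have h1 : col j ≤ m := single_le_sum (f := col) (fun _ _ => Nat.zero_le _) (mem_univ j)
  split_ifs with h2 h3
  · simp only [b, dampedTheta]
    rw [Nat.choose_eq_zero_of_lt (show col j - r i + 1 - m < 3 by omega)]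
    simp
  · omega
  · rfl

theorem mainTheorem5 (q : ℕ → ℝ) (hq : ∀ k, 2 ≤ k → q k ≠ 0)
    (hf : seriesOfSecondQuotients q ∈ totallyPositiveSeries)
    (a : ℝ) (ha : 3.503 ≤ a ^ 2) :
    termwiseProduct (seriesOfSecondQuotients q) (partialTheta a) =
        PowerSeries.mk (fun k =>
          1 / (a ^ (k * (k - 1)) * ∏ j ∈ Finset.Icc 2 k, q j ^ (k + 1 - j))) ∧
      termwiseProduct (seriesOfSecondQuotients q) (partialTheta a) ∈ totallyPositiveSeries := by
  constructor
  · ext k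
    simp only [termwiseProduct, seriesOfSecondQuotients, partialTheta, PowerSeries.coeff_mk]
    rw [div_mul_div_comm, one_mul, mul_comm]
  · obtain ⟨α, hα, hfα⟩ := hf
    have hcoeff : ∀ k, α k = 1 / ∏ j ∈ Finset.Icc 2 k, q j ^ (k + 1 - j) := by
      intro k
      have := congrArg (PowerSeries.coeff k) hfα
      simpa [seriesOfSecondQuotients] using this.symm
    have hpos : ∀ k, 0 < α k := by
      intro k
      refine lt_of_le_of_ne (hα.nonneg k) (Ne.symm ?_)
      rw [hcoeff]
      exact one_div_ne_zero (prod_ne_zero_iff.2 fun j hj => pow_ne_zero _ (hq j (mem_Icc.1 hj).1))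
    refine ⟨_, hα.mul_partialTheta hpos ha, ?_⟩
    ext k
    rw [hfα]
    simp only [termwiseProduct, partialTheta, PowerSeries.coeff_mk]
    rw [one_div, ← pow_mul, Nat.choose_two_right, Nat.mul_div_cancel' (Nat.even_mul_pred_self k).two_dvd]
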